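/- Let $k\ge 10^3$ be an integer and let $\eta\ge 0.999$ be real. Let $r>0$ be real and let $m$ be a positive integer divisible by $4^{k-1}$. Let $X$ be the two-dimensional dataset (with multiplicities) consisting, for each $i=1,\dots,k$, of $m/4^{\,i-1}$ points at $\big((2^i-2)r,\;2^{i-2}r\big)$ and $m/4^{\,i-1}$ points at $\big((2^i-2)r,\;-2^{i-2}r\big)$; for each $i$, these $2m/4^{\,i-1}$ points form the cluster $A_i$. Run $k$ iterations of k-means++ seeding on $X$: the first center is chosen uniformly at random among the points of $X$, and each subsequent center is a point $x$ of $X$ chosen with probability proportional to $\min_{c\in C}\|x-c\|^2$, where $C$ is the set of previously chosen centers. Say that $A_i$ is covered if at least one of the $k$ chosen centers is a point of $A_i$. Then $$\Pr\big[\text{more than } \eta k \text{ of the clusters } A_1,\dots,A_k \text{ are covered}\big]\;\le\; 2\sqrt{k}\cdot 2^{-k/300}.$$ -/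

import Mathlib

open scoped ENNReal

noncomputable section

namespace KMeansPP

/-- The Euclidean plane. -/
abbrev Plane := EuclideanSpace ℝ (Fin 2)

/-! ### The seeding algorithm

A dataset (with multiplicities) is a family `X : ι → Plane` over a finite index type, one index for
each data point. Centers are data points; a list `C : List ι` records the centers chosen so far. -/

section Algorithm

variable {ι : Type} [Fintype ι]

/-- `min_{c ∈ C} ‖x - c‖²`, the squared distance from `x` to its nearest center
(`⊤` if there is no center yet). -/
def minSqDist (X : ι → Plane) (C : List ι) (x : Plane) : ℝ≥0∞ :=
  ⨅ c ∈ C, edist x (X c) ^ 2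

/-- The k-means cost `φ_C(X)` of the dataset with respect to the centers `C`. -/
def potential (X : ι → Plane) (C : List ι) : ℝ≥0∞ :=
  ∑ i, minSqDist X C (X i)

theorem potential_ne_top (X : ι → Plane) {C : List ι} (hC : C ≠ []) : potential X C ≠ ⊤ := by
  obtain ⟨c, hc⟩ := List.exists_mem_of_ne_nil C hC
  refine ENNReal.sum_ne_top.2 fun i _ => ?_
  exact ne_top_of_le_ne_top (ENNReal.pow_ne_top (edist_ne_top (X i) (X c))) (iInf₂_le c hc)

open Classical in
/-- The law of the next center given the centers chosen so far. The first center is uniform among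
the data points; each later one is a data point drawn with probability proportional to its squared
distance to the nearest chosen center. (If every data point already coincides with a center, all
these weights vanish, and by convention the next center is uniform.) -/
def nextCenter [Nonempty ι] (X : ι → Plane) (C : List ι) : PMF ι :=
  if h : C = [] ∨ potential X C = 0 then PMF.uniformOfFintype ι
  else PMF.normalize (fun i => minSqDist X C (X i))
    (by rw [tsum_fintype]; exact fun h0 => h (Or.inr h0))
    (by rw [tsum_fintype]; exact potential_ne_top X fun h0 => h (Or.inl h0))

/-- The law of the list of centers (most recent first) chosen in the first `n` iterations of
the k-means++ seeding algorithm. -/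
def kmeanspp [Nonempty ι] (X : ι → Plane) : ℕ → PMF (List ι)
  | 0 => PMF.pure []
  | n + 1 => (kmeanspp X n).bind fun C => (nextCenter X C).map fun c => c :: C

end Algorithm

/-! ### The two-dimensional dataset -/

/-- Indices of the data points. Cluster number `i` (counted from `0`) is a vertical bar with
`m / 4 ^ i` points at its upper end (`true`) and as many at its lower end (`false`). -/
abbrev DataIndex (k m : ℕ) : Type := (i : Fin k) × (Bool × Fin (m / 4 ^ (i : ℕ)))

/-- The location of a data point: the ends of bar number `i` (counted from `0`) are
`((2 ^ (i + 1) - 2) r, ± 2 ^ i r / 2)`, that is `(0, ± r / 2)`, `(2 r, ± r)`, `(6 r, ± 2 r)`, ... -/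
def dataset (k m : ℕ) (r : ℝ) (x : DataIndex k m) : Plane :=
  !₂[(2 ^ ((x.1 : ℕ) + 1) - 2) * r, (if x.2.1 then 1 else -1) * (2 ^ (x.1 : ℕ) * r / 2)]

theorem dataIndex_nonempty {k m : ℕ} (hk : 0 < k) (hm : 0 < m) : Nonempty (DataIndex k m) :=
  ⟨⟨⟨0, hk⟩, true, ⟨0, by simpa using hm⟩⟩⟩

/-- The number of clusters covered by the centers `C`: those `i` such that some center in `C` is a
data point of the `i`-th vertical bar. -/
def numCovered {k m : ℕ} (C : List (DataIndex k m)) : ℕ :=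
  Nat.card {i : Fin k // ∃ c ∈ C, c.1 = i}

end KMeansPP

end

open scoped ENNReal

namespace KMeansPP

/-! Put `w = m r²`. The point counts fall by 4 per bar while squared lengths grow by 4, so any bar
with a free end costs at least `w`, and a bar to the right of some center costs at most `17w/2`.
Covering more than `0.999k` bars with `k` centers leaves fewer than `k/1000` wasted centers, so
nearly all covered bars keep a free end. Once `3k/4` centers are placed, covered bars then hold a
constant share of the cost, and avoiding waste becomes exponentially unlikely.

Bars left of the first center have no such cost bound. So `L ≈ k/600` is fixed: the first center
misses the first `L` bars with probability at most `4^(-L)`, and otherwise only those `L` bars can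
be expensive. The potential `progress` discounts each of them when covered, which happens at most
`L` times, and shrinks by `7/8` in expectation per late step (`sum_barCost_mul_stepFactor_le`).
Markov's inequality finishes (`prob_covered_le`). -/

/-! ### Expectations of discrete laws -/

/-- The expectation of a nonnegative function under a probability mass function. -/
noncomputable def expect {α : Type} (p : PMF α) (f : α → ℝ≥0∞) : ℝ≥0∞ := ∑' a, p a * f a

theorem expect_bind {α β : Type} (p : PMF α) (q : α → PMF β) (f : β → ℝ≥0∞) :
    expect (p.bind q) f = expect p fun a => expect (q a) f := by
  simp only [expect, PMF.bind_apply, ← ENNReal.tsum_mul_right, ← ENNReal.tsum_mul_left]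
  rw [ENNReal.tsum_comm]
  simp only [mul_assoc]

theorem expect_pure {α : Type} (a : α) (f : α → ℝ≥0∞) : expect (PMF.pure a) f = f a := by
  classical
  rw [expect, tsum_eq_single a]
  · simp
  · intro b hb
    simp [PMF.pure_apply, hb]

theorem expect_map {α β : Type} (g : α → β) (p : PMF α) (f : β → ℝ≥0∞) :
    expect (p.map g) f = expect p fun a => f (g a) := by
  rw [PMF.map, expect_bind]
  simp only [Function.comp, expect_pure]

theorem expect_mono {α : Type} (p : PMF α) {f g : α → ℝ≥0∞} (h : ∀ a ∈ p.support, f a ≤ g a) :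
    expect p f ≤ expect p g := by
  refine ENNReal.tsum_le_tsum fun a => ?_
  by_cases ha : p a = 0
  · simp [ha]
  · exact mul_le_mul_right (h a ((PMF.mem_support_iff p a).2 ha)) _

theorem expect_const {α : Type} (p : PMF α) (c : ℝ≥0∞) : expect p (fun _ => c) = c := by
  rw [expect, ENNReal.tsum_mul_right, p.tsum_coe, one_mul]

theorem expect_mul_left {α : Type} (p : PMF α) (c : ℝ≥0∞) (f : α → ℝ≥0∞) :
    expect p (fun a => c * f a) = c * expect p f := by
  simp only [expect, ← ENNReal.tsum_mul_left]
  exact tsum_congr fun a => by ring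

theorem expect_add {α : Type} (p : PMF α) (f g : α → ℝ≥0∞) :
    expect p (fun a => f a + g a) = expect p f + expect p g := by
  simp only [expect, mul_add, ENNReal.tsum_add]

theorem toOuterMeasure_le_expect {α : Type} (p : PMF α) (s : Set α) {f : α → ℝ≥0∞}
    (h : ∀ a ∈ p.support, a ∈ s → 1 ≤ f a) : p.toOuterMeasure s ≤ expect p f := by
  rw [PMF.toOuterMeasure_apply]
  refine ENNReal.tsum_le_tsum fun a => ?_
  by_cases ha : a ∈ s
  · rw [Set.indicator_of_mem ha]
    by_cases h0 : p a = 0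
    · simp [h0]
    · exact le_mul_of_one_le_right' (h a ((PMF.mem_support_iff p a).2 h0) ha)
  · simp [Set.indicator_of_notMem ha]

/-! ### General facts about the seeding algorithm -/

section Seeding

variable {ι : Type} [Fintype ι] [Nonempty ι] (X : ι → Plane)

theorem expect_kmeanspp_succ (n : ℕ) (f : List ι → ℝ≥0∞) :
    expect (kmeanspp X (n + 1)) f =
      expect (kmeanspp X n) fun C => expect (nextCenter X C) fun c => f (c :: C) := by
  rw [kmeanspp, expect_bind]
  simp only [expect_map]

theorem length_of_mem_support_kmeanspp (n : ℕ) :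
    ∀ C ∈ (kmeanspp X n).support, C.length = n := by
  induction n with
  | zero => simp [kmeanspp]
  | succ n ih =>
    intro C hC
    rw [kmeanspp, PMF.mem_support_bind_iff] at hC
    obtain ⟨D, hD, hC⟩ := hC
    rw [PMF.mem_support_map_iff] at hC
    obtain ⟨c, -, rfl⟩ := hC
    simp [ih D hD]

theorem expect_nextCenter_le {C : List ι} (hC : C ≠ []) (hpot : potential X C ≠ 0)
    {f : ι → ℝ≥0∞} {a : ℝ≥0∞}
    (h : ∑ i, minSqDist X C (X i) * f i ≤ a * potential X C) :
    expect (nextCenter X C) f ≤ a := by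
  have hn : ¬ (C = [] ∨ potential X C = 0) := by tauto
  have htop := potential_ne_top X hC
  rw [expect, nextCenter, dif_neg hn, tsum_fintype]
  simp only [PMF.normalize_apply, tsum_fintype]
  calc ∑ i, minSqDist X C (X i) * (∑ i, minSqDist X C (X i))⁻¹ * f i
      = (∑ i, minSqDist X C (X i) * f i) * (potential X C)⁻¹ := by
        rw [Finset.sum_mul]
        exact Finset.sum_congr rfl fun i _ => by rw [potential]; ring
    _ ≤ a * potential X C * (potential X C)⁻¹ := mul_le_mul_left h _
    _ = a := by rw [mul_assoc, ENNReal.mul_inv_cancel hpot htop, mul_one]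

/-- Lists are most recent first, so the last entry is the first, uniform center, and later steps
leave it alone. -/
theorem expect_kmeanspp_getLast (p : ι → Prop) [DecidablePred p] (n : ℕ) :
    expect (kmeanspp X (n + 1)) (fun C => if ∃ c ∈ C.getLast?, p c then 1 else 0) =
      expect (PMF.uniformOfFintype ι) (fun c => if p c then 1 else 0) := by
  induction n with
  | zero =>
    rw [expect_kmeanspp_succ, kmeanspp, expect_pure, nextCenter, dif_pos (Or.inl rfl)]
    simp
  | succ n ih =>
    rw [expect_kmeanspp_succ, ← ih]
    refine le_antisymm (expect_mono _ fun C hC => ?_) (expect_mono _ fun C hC => ?_) <;>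
    · have hl := length_of_mem_support_kmeanspp X _ C hC
      obtain ⟨d, D, rfl⟩ := List.exists_cons_of_length_eq_add_one hl
      simp only [List.getLast?_cons_cons, expect_const, le_refl]

end Seeding

/-! ### Geometry of the dataset -/

section Geometry

variable {k m : ℕ} {r : ℝ}

theorem edist_sq_dataset (x y : DataIndex k m) :
    edist (dataset k m r x) (dataset k m r y) ^ 2 =
      ENNReal.ofReal (4 * (2 ^ (x.1 : ℕ) - 2 ^ (y.1 : ℕ)) ^ 2 * r ^ 2 +
        ((if x.2.1 then 1 else -1) * 2 ^ (x.1 : ℕ) - (if y.2.1 then 1 else -1) * 2 ^ (y.1 : ℕ)) ^ 2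
          / 4 * r ^ 2) := by
  rw [edist_dist, ← ENNReal.ofReal_pow dist_nonneg, EuclideanSpace.dist_eq, Real.sq_sqrt]
  · congr 1
    simp only [dataset, Fin.sum_univ_two, Real.dist_eq, sq_abs, Matrix.cons_val_zero,
      Matrix.cons_val_one]
    generalize (if x.2.1 = true then (1 : ℝ) else -1) = s
    generalize (if y.2.1 = true then (1 : ℝ) else -1) = t
    ring
  · positivity

theorem minSqDist_le_of_lt {C : List (DataIndex k m)} {c x : DataIndex k m} (hc : c ∈ C)
    (h : c.1 < x.1) :
    minSqDist (dataset k m r) C (dataset k m r x) ≤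
      ENNReal.ofReal (17 / 4 * 4 ^ (x.1 : ℕ) * r ^ 2) := by
  refine (iInf₂_le c hc).trans ?_
  rw [edist_sq_dataset]
  refine ENNReal.ofReal_le_ofReal ?_
  have h4 : (4 : ℝ) ^ (x.1 : ℕ) = (2 ^ (x.1 : ℕ)) ^ 2 := by
    rw [← pow_mul, mul_comm, pow_mul]; norm_num
  have hle : (2 : ℝ) ^ (c.1 : ℕ) ≤ 2 ^ (x.1 : ℕ) :=
    pow_le_pow_right₀ (by norm_num) (Fin.lt_def.1 h).le
  have hpos : (0 : ℝ) < 2 ^ (c.1 : ℕ) := by positivity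
  rw [h4, ← add_mul]
  generalize (2 : ℝ) ^ (c.1 : ℕ) = b at *
  generalize (2 : ℝ) ^ (x.1 : ℕ) = a at *
  refine mul_le_mul_of_nonneg_right ?_ (sq_nonneg r)
  -- Worst case, opposite ends: `4(a-b)² + (a+b)²/4 ≤ 17a²/4` for `0 < b ≤ a`.
  split_ifs <;> nlinarith

/-- The horizontal gap to another bar is already at least the length of the bar of `x`, which is
also the distance to its other end. -/
theorem le_minSqDist_of_forall {C : List (DataIndex k m)} {x : DataIndex k m}
    (h : ∀ c ∈ C, c.1 = x.1 → c.2.1 ≠ x.2.1) :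
    ENNReal.ofReal (4 ^ (x.1 : ℕ) * r ^ 2) ≤
      minSqDist (dataset k m r) C (dataset k m r x) := by
  refine le_iInf₂ fun c hc => ?_
  rw [edist_sq_dataset]
  refine ENNReal.ofReal_le_ofReal ?_
  have h4 : (4 : ℝ) ^ (x.1 : ℕ) = (2 ^ (x.1 : ℕ)) ^ 2 := by
    rw [← pow_mul, mul_comm, pow_mul]; norm_num
  rw [h4, ← add_mul]
  refine mul_le_mul_of_nonneg_right ?_ (sq_nonneg r)
  have ha : (0 : ℝ) < 2 ^ (x.1 : ℕ) := by positivity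
  rcases lt_trichotomy (c.1 : ℕ) x.1 with hlt | heq | hgt
  · have hle : (2 : ℝ) ^ ((c.1 : ℕ) + 1) ≤ 2 ^ (x.1 : ℕ) :=
      pow_le_pow_right₀ (by norm_num) hlt
    rw [pow_succ] at hle
    refine le_add_of_le_of_nonneg ?_ (by positivity)
    nlinarith
  · have hne := h c hc (Fin.ext heq)
    rw [show (2 : ℝ) ^ (c.1 : ℕ) = 2 ^ (x.1 : ℕ) by rw [heq]]
    generalize (2 : ℝ) ^ (x.1 : ℕ) = a at *
    generalize c.2.1 = s at *
    generalize x.2.1 = t at *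
    cases s <;> cases t <;> simp at hne ⊢ <;> nlinarith
  · have hle : (2 : ℝ) ^ ((x.1 : ℕ) + 1) ≤ 2 ^ (c.1 : ℕ) :=
      pow_le_pow_right₀ (by norm_num) hgt
    rw [pow_succ] at hle
    refine le_add_of_le_of_nonneg ?_ (by positivity)
    nlinarith

/-- The part of the cost that is due to the `i`-th vertical bar. -/
noncomputable def barCost (r : ℝ) (C : List (DataIndex k m)) (i : Fin k) : ℝ≥0∞ :=
  ∑ p : Bool × Fin (m / 4 ^ (i : ℕ)), minSqDist (dataset k m r) C (dataset k m r ⟨i, p⟩)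

theorem sum_minSqDist_mul (C : List (DataIndex k m)) (β : Fin k → ℝ≥0∞) :
    ∑ x : DataIndex k m, minSqDist (dataset k m r) C (dataset k m r x) * β x.1 =
      ∑ i, barCost r C i * β i := by
  rw [Fintype.sum_sigma]
  exact Finset.sum_congr rfl fun i _ => by rw [barCost, Finset.sum_mul]

theorem potential_dataset (C : List (DataIndex k m)) :
    potential (dataset k m r) C = ∑ i, barCost r C i := by
  simpa [potential] using sum_minSqDist_mul (r := r) C fun _ => 1

theorem div_four_pow_mul (hdvd : 4 ^ (k - 1) ∣ m) (i : Fin k) :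
    ((m / 4 ^ (i : ℕ) : ℕ) : ℝ) * 4 ^ (i : ℕ) = m := by
  have h : 4 ^ (i : ℕ) ∣ m := (pow_dvd_pow 4 (by omega)).trans hdvd
  exact_mod_cast Nat.div_mul_cancel h

theorem barCost_le (hdvd : 4 ^ (k - 1) ∣ m) {C : List (DataIndex k m)} {c : DataIndex k m}
    (hc : c ∈ C) {i : Fin k} (h : c.1 < i) :
    barCost r C i ≤ ENNReal.ofReal (17 / 2 * (m * r ^ 2)) := by
  refine (Finset.sum_le_sum fun p _ => minSqDist_le_of_lt (x := ⟨i, p⟩) hc h).trans_eq ?_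
  simp only
  rw [Finset.sum_const, nsmul_eq_mul, ← ENNReal.ofReal_natCast, ← ENNReal.ofReal_mul (by positivity),
    Finset.card_univ, Fintype.card_prod, Fintype.card_bool, Fintype.card_fin,
    ← div_four_pow_mul hdvd i]
  congr 1
  push_cast
  ring

theorem le_barCost (hdvd : 4 ^ (k - 1) ∣ m) {C : List (DataIndex k m)} {i : Fin k} (b : Bool)
    (h : ∀ c ∈ C, c.1 = i → c.2.1 ≠ b) :
    ENNReal.ofReal (m * r ^ 2) ≤ barCost r C i := by
  rw [barCost, Fintype.sum_prod_type]
  refine le_trans ?_ (Finset.single_le_sum (fun _ _ => zero_le) (Finset.mem_univ b))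
  refine le_trans (Eq.le ?_) (Finset.sum_le_sum fun j _ =>
    le_minSqDist_of_forall (x := ⟨i, b, j⟩) h)
  simp only
  rw [Finset.sum_const, nsmul_eq_mul, ← ENNReal.ofReal_natCast, ← ENNReal.ofReal_mul (by positivity),
    Finset.card_univ, Fintype.card_fin, ← div_four_pow_mul hdvd i, mul_assoc]

theorem barCost_ne_top {C : List (DataIndex k m)} (hC : C ≠ []) (i : Fin k) :
    barCost r C i ≠ ⊤ := by
  have h := potential_ne_top (dataset k m r) hC
  rw [potential_dataset] at h
  exact ENNReal.sum_ne_top.1 h i (Finset.mem_univ i)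

end Geometry

/-! ### Covered bars -/

section Covered

variable {k m : ℕ}

/-- The bars that contain a center of `C`. -/
def covered (C : List (DataIndex k m)) : Finset (Fin k) := (C.map Sigma.fst).toFinset

/-- The bars with a center of `C` at the end `b`. -/
def coveredEnd (b : Bool) (C : List (DataIndex k m)) : Finset (Fin k) :=
  covered (C.filter fun c => c.2.1 = b)

theorem mem_covered {C : List (DataIndex k m)} {i : Fin k} :
    i ∈ covered C ↔ ∃ c ∈ C, c.1 = i := by
  simp only [covered, List.mem_toFinset, List.mem_map]

theorem mem_coveredEnd {b : Bool} {C : List (DataIndex k m)} {i : Fin k} :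
    i ∈ coveredEnd b C ↔ ∃ c ∈ C, c.2.1 = b ∧ c.1 = i := by
  simp only [coveredEnd, mem_covered, List.mem_filter, decide_eq_true_eq, and_assoc]

theorem covered_cons (c : DataIndex k m) (C : List (DataIndex k m)) :
    covered (c :: C) = insert c.1 (covered C) := by
  simp [covered]

theorem numCovered_eq (C : List (DataIndex k m)) : numCovered C = (covered C).card := by
  rw [numCovered, Nat.card_eq_fintype_card, Fintype.card_subtype]
  congr 1
  ext i
  simp [mem_covered]

theorem card_covered_le (C : List (DataIndex k m)) : (covered C).card ≤ C.length :=
  (List.toFinset_card_le _).trans_eq (List.length_map _)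

theorem coveredEnd_union (C : List (DataIndex k m)) :
    coveredEnd true C ∪ coveredEnd false C = covered C := by
  ext i
  simp only [Finset.mem_union, mem_coveredEnd, mem_covered]
  constructor
  · rintro (⟨c, hc, -, h⟩ | ⟨c, hc, -, h⟩) <;> exact ⟨c, hc, h⟩
  · rintro ⟨c, hc, h⟩
    cases hb : c.2.1
    · exact Or.inr ⟨c, hc, hb, h⟩
    · exact Or.inl ⟨c, hc, hb, h⟩

theorem card_covered_add_card_inter_le (C : List (DataIndex k m)) :
    (covered C).card + (coveredEnd true C ∩ coveredEnd false C).card ≤ C.length := by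
  rw [← coveredEnd_union, Finset.card_union_add_card_inter]
  refine (add_le_add (card_covered_le _) (card_covered_le _)).trans_eq ?_
  induction C with
  | nil => rfl
  | cons c C ih => cases h : c.2.1 <;> simp [h] at ih ⊢ <;> omega

/-- Bars with a center at exactly one end. -/
def halfCovered (C : List (DataIndex k m)) : Finset (Fin k) :=
  covered C \ (coveredEnd true C ∩ coveredEnd false C)

/-- A bar with centers at both ends uses up a wasted center, so such bars number at most `C.length`
minus the covered count. -/
theorem two_mul_card_covered_le (C : List (DataIndex k m)) :
    2 * (covered C).card ≤ C.length + (halfCovered C).card := by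
  have h1 := card_covered_add_card_inter_le C
  have h2 := Finset.le_card_sdiff (coveredEnd true C ∩ coveredEnd false C) (covered C)
  rw [← halfCovered] at h2
  omega

theorem le_barCost_of_mem_halfCovered {r : ℝ} (hdvd : 4 ^ (k - 1) ∣ m) {C : List (DataIndex k m)}
    {i : Fin k} (hi : i ∈ halfCovered C) : ENNReal.ofReal (m * r ^ 2) ≤ barCost r C i := by
  have h : ∃ b, i ∉ coveredEnd b C := by
    by_contra! h
    rw [halfCovered, Finset.mem_sdiff, Finset.mem_inter] at hi
    exact hi.2 ⟨h true, h false⟩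
  obtain ⟨b, hb⟩ := h
  exact le_barCost hdvd b fun c hc hci hcb => hb (mem_coveredEnd.2 ⟨c, hc, hcb, hci⟩)

end Covered

/-! ### The supermartingale -/

section Supermartingale

variable {k m : ℕ} {r : ℝ}

/-- Sequences of centers that start in one of the first `L` bars and for which fewer than `k / 1000`
centers have been wasted on bars that were already covered. -/
def IsGood (L : ℕ) (C : List (DataIndex k m)) : Prop :=
  (∃ c ∈ C.getLast?, (c.1 : ℕ) < L) ∧ 1000 * (C.length - (covered C).card) < k

open Classical in
/-- A function of the centers whose expectation decays geometrically late in the seeding: a wasted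
center costs a factor `1 / 2`, a newly covered bar among the first `L` a factor `7 / 8`. -/
noncomputable def progress (L : ℕ) (C : List (DataIndex k m)) : ℝ≥0∞ :=
  if IsGood L C then
    ENNReal.ofReal ((1 / 2) ^ (C.length - (covered C).card) *
      (7 / 8) ^ ((covered C).filter fun i : Fin k => (i : ℕ) < L).card)
  else 0

/-- The factor by which `progress` changes when a center in bar `i` is added. -/
noncomputable def stepFactor (L : ℕ) (C : List (DataIndex k m)) (i : Fin k) : ℝ :=
  if i ∈ covered C then 1 / 2 else if (i : ℕ) < L then 7 / 8 else 1

theorem stepFactor_nonneg (L : ℕ) (C : List (DataIndex k m)) (i : Fin k) :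
    0 ≤ stepFactor L C i := by
  unfold stepFactor; split_ifs <;> norm_num

theorem progress_le_one (L : ℕ) (C : List (DataIndex k m)) : progress L C ≤ 1 := by
  unfold progress
  split_ifs
  · rw [ENNReal.ofReal_le_one]
    exact mul_le_one₀ (pow_le_one₀ (by norm_num) (by norm_num)) (by positivity)
      (pow_le_one₀ (by norm_num) (by norm_num))
  · exact zero_le_one

theorem isGood_of_cons {L : ℕ} {C : List (DataIndex k m)} (hC : C ≠ []) {c : DataIndex k m}
    (h : IsGood L (c :: C)) : IsGood L C := by
  obtain ⟨d, D, rfl⟩ := List.exists_cons_of_ne_nil hC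
  refine ⟨by simpa only [List.getLast?_cons_cons] using h.1, lt_of_le_of_lt ?_ h.2⟩
  have := Finset.card_insert_le c.1 (covered (d :: D))
  rw [covered_cons c, List.length_cons (a := c)]
  omega

/-- Equality holds while the list stays good; a list that stops being good drops to `0`. -/
theorem progress_cons_le {L : ℕ} {C : List (DataIndex k m)} (hC : C ≠ []) (c : DataIndex k m) :
    progress L (c :: C) ≤ progress L C * ENNReal.ofReal (stepFactor L C c.1) := by
  by_cases h : IsGood L (c :: C)
  swap
  · simp [progress, h]
  rw [progress, progress, if_pos h, if_pos (isGood_of_cons hC h),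
    ← ENNReal.ofReal_mul (by positivity), covered_cons, List.length_cons]
  refine ENNReal.ofReal_le_ofReal (Eq.le ?_)
  -- Makes the truncated subtraction in the waste count exact.
  have hle := card_covered_le C
  unfold stepFactor
  split_ifs with h1 h2
  · rw [Finset.insert_eq_of_mem h1, Nat.succ_sub hle, pow_succ]
    ring
  · rw [Finset.card_insert_of_notMem h1, Nat.add_sub_add_right, Finset.filter_insert, if_pos h2,
      Finset.card_insert_of_notMem (fun h => h1 (Finset.mem_filter.1 h).1), pow_succ]
    ring
  · rw [Finset.card_insert_of_notMem h1, Nat.add_sub_add_right, Finset.filter_insert, if_neg h2,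
      mul_one]

theorem sum_barCost_mul_stepFactor_le (hdvd : 4 ^ (k - 1) ∣ m) {L : ℕ}
    {C : List (DataIndex k m)} (hC : IsGood L C) (hlen : 3 * k ≤ 4 * C.length) :
    ∑ i, barCost r C i * ENNReal.ofReal (stepFactor L C i) ≤
      ENNReal.ofReal (7 / 8) * ∑ i, barCost r C i := by
  obtain ⟨⟨c, hc, hcL⟩, hw⟩ := hC
  have hcC : c ∈ C := List.mem_of_getLast? hc
  have hne : C ≠ [] := List.ne_nil_of_mem hcC
  obtain ⟨V, hV0, hV⟩ : ∃ V : Fin k → ℝ, (∀ i, 0 ≤ V i) ∧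
      ∀ i, barCost r C i = ENNReal.ofReal (V i) :=
    ⟨fun i => (barCost r C i).toReal, fun i => ENNReal.toReal_nonneg,
      fun i => (ENNReal.ofReal_toReal (barCost_ne_top hne i)).symm⟩
  set w : ℝ := m * r ^ 2 with hw_def
  have hw0 : 0 ≤ w := by positivity
  have hhalf : ∀ i ∈ halfCovered C, w ≤ V i := fun i hi =>
    (ENNReal.ofReal_le_ofReal_iff (hV0 i)).1 (hV i ▸ le_barCost_of_mem_halfCovered hdvd hi)
  have hright : ∀ i : Fin k, ¬ (i : ℕ) < L → V i ≤ 17 / 2 * w := fun i hi =>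
    (ENNReal.ofReal_le_ofReal_iff (by positivity)).1
      (hV i ▸ barCost_le hdvd hcC (Fin.lt_def.2 (by omega)))
  have hcov : ((halfCovered C).card : ℝ) * w ≤ ∑ i ∈ covered C, V i := by
    rw [← nsmul_eq_mul]
    exact (Finset.card_nsmul_le_sum _ _ _ hhalf).trans
      (Finset.sum_le_sum_of_subset_of_nonneg Finset.sdiff_subset fun i _ _ => hV0 i)
  have hunc : ∑ i ∈ (covered C)ᶜ, (if (i : ℕ) < L then 0 else V i) ≤
      ((k : ℝ) - (covered C).card) * (17 / 2 * w) := by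
    have hcard : (((covered C)ᶜ.card : ℕ) : ℝ) = (k : ℝ) - (covered C).card := by
      rw [Finset.card_compl, Fintype.card_fin, Nat.cast_sub]
      simpa using Finset.card_le_univ (covered C)
    rw [← hcard, ← nsmul_eq_mul]
    refine Finset.sum_le_card_nsmul _ _ _ fun i _ => ?_
    split_ifs with h
    · positivity
    · exact hright i h
  -- With costs `A` (covered), `B` (uncovered, first `L`) and `R` (other uncovered), `A/2 + 7B/8 + R
  -- ≤ 7(A+B+R)/8` amounts to `R ≤ 3A`.
  have hmain : ∑ i ∈ (covered C)ᶜ, (if (i : ℕ) < L then 0 else V i) ≤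
      3 * ∑ i ∈ covered C, V i := by
    refine hunc.trans (le_trans ?_ (mul_le_mul_of_nonneg_left hcov (by norm_num)))
    rw [← mul_assoc _ (17 / 2) w, ← mul_assoc 3]
    refine mul_le_mul_of_nonneg_right ?_ hw0
    have h1 := two_mul_card_covered_le C
    have h2 := card_covered_le C
    -- The right side is at least `29 * (covered C).card - 6 * C.length`, about `23 * C.length ≥
    -- 17.25k` up to waste `0.029k`.
    have h3 : 17 * k ≤ 6 * (halfCovered C).card + 17 * (covered C).card := by omega
    have h4 : 17 * (k : ℝ) ≤ 6 * (halfCovered C).card + 17 * (covered C).card := by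
      exact_mod_cast h3
    linarith
  simp only [hV, ← ENNReal.ofReal_mul (hV0 _)]
  rw [← ENNReal.ofReal_sum_of_nonneg fun i _ => mul_nonneg (hV0 i) (stepFactor_nonneg L C i),
    ← ENNReal.ofReal_sum_of_nonneg fun i _ => hV0 i, ← ENNReal.ofReal_mul (by norm_num)]
  refine ENNReal.ofReal_le_ofReal ?_
  rw [← Finset.sum_add_sum_compl (covered C), ← Finset.sum_add_sum_compl (covered C) V]
  have e1 : ∑ i ∈ covered C, V i * stepFactor L C i = 1 / 2 * ∑ i ∈ covered C, V i := by
    rw [Finset.mul_sum]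
    exact Finset.sum_congr rfl fun i hi => by rw [stepFactor, if_pos hi, mul_comm]
  have e2 : ∑ i ∈ (covered C)ᶜ, V i * stepFactor L C i = 7 / 8 * ∑ i ∈ (covered C)ᶜ, V i +
      1 / 8 * ∑ i ∈ (covered C)ᶜ, (if (i : ℕ) < L then 0 else V i) := by
    rw [Finset.mul_sum, Finset.mul_sum, ← Finset.sum_add_distrib]
    refine Finset.sum_congr rfl fun i hi => ?_
    rw [stepFactor, if_neg (Finset.mem_compl.1 hi)]
    split_ifs <;> ring
  rw [e1, e2]
  linarith

/-- Rules out the uniform fallback in `nextCenter`: some half-covered bar still has positive cost.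
-/
theorem potential_ne_zero_of_isGood (hm : 0 < m) (hr : 0 < r) (hdvd : 4 ^ (k - 1) ∣ m) {L : ℕ}
    {C : List (DataIndex k m)} (hC : IsGood L C) (hlen : 3 * k ≤ 4 * C.length) :
    potential (dataset k m r) C ≠ 0 := by
  have h1 := two_mul_card_covered_le C
  have h2 := card_covered_le C
  have h3 := hC.2
  obtain ⟨i, hi⟩ : (halfCovered C).Nonempty := Finset.card_pos.1 (by omega)
  have hpos : 0 < ENNReal.ofReal (m * r ^ 2) := ENNReal.ofReal_pos.2 (by positivity)
  rw [potential_dataset]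
  exact (hpos.trans_le ((le_barCost_of_mem_halfCovered hdvd hi).trans
    (Finset.single_le_sum (fun _ _ => zero_le) (Finset.mem_univ i)))).ne'

/-- Shifting by `L` bars divides the point count by at least `4 ^ L`. -/
theorem card_filter_le (L : ℕ) :
    4 ^ L * (Finset.univ.filter fun c : DataIndex k m => L ≤ (c.1 : ℕ)).card ≤
      Fintype.card (DataIndex k m) := by
  have h1 : (Finset.univ.filter fun c : DataIndex k m => L ≤ (c.1 : ℕ)).card =
      ∑ i ∈ Finset.range k, if L ≤ i then 2 * (m / 4 ^ i) else 0 := by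
    rw [Finset.card_filter, Fintype.sum_sigma,
      Finset.sum_range fun i => if L ≤ i then 2 * (m / 4 ^ i) else 0]
    refine Finset.sum_congr rfl fun i _ => ?_
    split_ifs <;> simp
  have h2 : Fintype.card (DataIndex k m) = ∑ i ∈ Finset.range k, 2 * (m / 4 ^ i) := by
    rw [Fintype.card_sigma, Finset.sum_range fun i => 2 * (m / 4 ^ i)]
    simp
  rw [h1, h2, ← Finset.sum_filter, Finset.mul_sum]
  have himg : (Finset.range k).filter (fun i => L ≤ i) = (Finset.range (k - L)).map
      (addRightEmbedding L) := by
    ext i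
    simp only [Finset.mem_filter, Finset.mem_range, Finset.mem_map, addRightEmbedding_apply]
    constructor
    · rintro ⟨h, h'⟩
      exact ⟨i - L, by omega, by omega⟩
    · rintro ⟨j, hj, rfl⟩
      omega
  rw [himg, Finset.sum_map]
  refine (Finset.sum_le_sum fun j _ => ?_).trans
    (Finset.sum_le_sum_of_subset (Finset.range_subset_range.2 (Nat.sub_le k L)))
  rw [addRightEmbedding_apply, pow_add, ← Nat.div_div_eq_div_mul, mul_left_comm]
  exact Nat.mul_le_mul_left 2 (Nat.mul_div_le _ _)

variable [Nonempty (DataIndex k m)]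

theorem expect_progress_cons_le (hk : 0 < k) (hm : 0 < m) (hr : 0 < r) (hdvd : 4 ^ (k - 1) ∣ m)
    {L : ℕ} {C : List (DataIndex k m)} (hlen : 3 * k ≤ 4 * C.length) :
    expect (nextCenter (dataset k m r) C) (fun c => progress L (c :: C)) ≤
      ENNReal.ofReal (7 / 8) * progress L C := by
  have hne : C ≠ [] := by rintro rfl; simp at hlen; omega
  refine (expect_mono _ fun c _ => progress_cons_le hne c).trans ?_
  rw [expect_mul_left, mul_comm]
  by_cases h : IsGood L C
  · refine mul_le_mul_left (expect_nextCenter_le _ hne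
      (potential_ne_zero_of_isGood hm hr hdvd h hlen) ?_) _
    rw [sum_minSqDist_mul C fun i => ENNReal.ofReal (stepFactor L C i), potential_dataset]
    exact sum_barCost_mul_stepFactor_le hdvd h hlen
  · simp [progress, h]

theorem expect_progress_le (hk : 0 < k) (hm : 0 < m) (hr : 0 < r) (hdvd : 4 ^ (k - 1) ∣ m)
    (L : ℕ) {n : ℕ} (hn : 3 * k ≤ 4 * n) (t : ℕ) :
    expect (kmeanspp (dataset k m r) (n + t)) (progress L) ≤ ENNReal.ofReal ((7 / 8) ^ t) := by
  induction t with
  | zero =>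
    refine (expect_mono _ fun C _ => progress_le_one L C).trans ?_
    simp [expect_const]
  | succ t ih =>
    rw [← add_assoc, expect_kmeanspp_succ, pow_succ', ENNReal.ofReal_mul (by norm_num)]
    refine (expect_mono _ fun C hC => expect_progress_cons_le hk hm hr hdvd ?_).trans ?_
    · rw [length_of_mem_support_kmeanspp _ _ C hC]; omega
    · rw [expect_mul_left]
      exact mul_le_mul_right ih _

/-! ### The first center -/

theorem expect_uniform_le (L : ℕ) :
    expect (PMF.uniformOfFintype (DataIndex k m)) (fun c => if L ≤ (c.1 : ℕ) then 1 else 0) ≤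
      ENNReal.ofReal ((1 / 4) ^ L) := by
  have h0 : Fintype.card (DataIndex k m) ≠ 0 := Fintype.card_ne_zero
  simp only [expect, PMF.uniformOfFintype_apply, tsum_fintype]
  rw [← Finset.mul_sum, Finset.sum_boole, mul_comm, ← div_eq_mul_inv]
  refine ENNReal.div_le_of_le_mul ?_
  rw [← ENNReal.ofReal_natCast, ← ENNReal.ofReal_natCast, ← ENNReal.ofReal_mul (by positivity)]
  refine ENNReal.ofReal_le_ofReal ?_
  rw [one_div, inv_pow, inv_mul_eq_div, le_div_iff₀' (by positivity)]
  exact_mod_cast card_filter_le (m := m) (k := k) L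

end Supermartingale

/-! ### Numerical estimates -/

theorem one_div_four_pow_le {k L : ℕ} (hL : k ≤ 600 * L) :
    (1 / 4 : ℝ) ^ L ≤ 2 ^ (-(k : ℝ) / 300) := by
  have h : (1 / 4 : ℝ) ^ L = 2 ^ (-(2 * L : ℝ)) := by
    rw [Real.rpow_neg (by norm_num), Real.rpow_mul (by norm_num), Real.rpow_natCast, one_div,
      inv_pow]
    norm_num
  have hL' : (k : ℝ) ≤ 600 * L := by exact_mod_cast hL
  rw [h]
  exact Real.rpow_le_rpow_of_exponent_le (by norm_num) (by linarith)

theorem two_pow_mul_seven_div_eight_pow_le {k a s : ℕ} (h : k + 300 * a ≤ 50 * s) :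
    (2 : ℝ) ^ a * (7 / 8) ^ s ≤ 2 ^ (-(k : ℝ) / 300) := by
  have h78 : (7 / 8 : ℝ) ≤ 2 ^ (-(1 / 6 : ℝ)) := by
    refine le_of_pow_le_pow_left₀ (n := 6) (by norm_num) (by positivity) ?_
    -- This reduces to `(7/8)^6 ≤ 1/2`.
    rw [← Real.rpow_natCast (2 ^ _), ← Real.rpow_mul (by norm_num)]
    norm_num
  have h' : (k : ℝ) + 300 * a ≤ 50 * s := by exact_mod_cast h
  calc (2 : ℝ) ^ a * (7 / 8) ^ s ≤ 2 ^ a * (2 ^ (-(1 / 6 : ℝ))) ^ s := by gcongr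
    _ = 2 ^ (a - s / 6 : ℝ) := by
      rw [← Real.rpow_natCast (2 ^ _), ← Real.rpow_mul (by norm_num), ← Real.rpow_natCast 2,
        ← Real.rpow_add (by norm_num)]
      congr 1
      ring
    _ ≤ 2 ^ (-(k : ℝ) / 300) :=
      Real.rpow_le_rpow_of_exponent_le (by norm_num) (by linarith)

theorem one_le_mul_progress {k m L a : ℕ} {C : List (DataIndex k m)} (hC : IsGood L C)
    (ha : C.length - (covered C).card ≤ a) :
    1 ≤ ENNReal.ofReal (2 ^ a * (8 / 7) ^ L) * progress L C := by
  rw [progress, if_pos hC, ← ENNReal.ofReal_mul (by positivity), ENNReal.one_le_ofReal]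
  have hL : ((covered C).filter fun i : Fin k => (i : ℕ) < L).card ≤ L := by
    have h := Finset.card_le_card_of_injOn (s := (covered C).filter fun i : Fin k => (i : ℕ) < L)
      (t := Finset.range L) (fun i => (i : ℕ))
      (fun i hi => by simpa using (Finset.mem_filter.1 hi).2) (Fin.val_injective.injOn)
    rwa [Finset.card_range] at h
  calc (1 : ℝ) = (2 ^ a * (8 / 7) ^ L) * ((1 / 2) ^ a * (7 / 8) ^ L) := by
        rw [mul_mul_mul_comm, ← mul_pow, ← mul_pow]
        norm_num
    _ ≤ _ := by
        refine mul_le_mul_of_nonneg_left (mul_le_mul ?_ ?_ (by positivity) (by positivity))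
          (by positivity)
        · exact pow_le_pow_of_le_one (by norm_num) (by norm_num) ha
        · exact pow_le_pow_of_le_one (by norm_num) (by norm_num) hL

theorem prob_covered_le {k m : ℕ} [Nonempty (DataIndex k m)] (hk : 1000 ≤ k) (hm : 0 < m)
    (hdvd : 4 ^ (k - 1) ∣ m) {r : ℝ} (hr : 0 < r) :
    (kmeanspp (dataset k m r) k).toOuterMeasure {C | 999 * k < 1000 * numCovered C} ≤
      ENNReal.ofReal (2 * 2 ^ (-(k : ℝ) / 300)) := by
  -- `L = ⌈k/600⌉` gives `4^(-L) ≤ 2^(-k/300)`; `n = ⌈3k/4⌉` starts the late phase. Of its `L + s`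
  -- steps, `L` pay for the discounts on the first `L` bars.
  obtain ⟨L, hL⟩ : ∃ L, L = (k + 599) / 600 := ⟨_, rfl⟩
  obtain ⟨n, hn⟩ : ∃ n, n = (3 * k + 3) / 4 := ⟨_, rfl⟩
  obtain ⟨s, hs⟩ : ∃ s, k = n + (L + s) := ⟨k - n - L, by omega⟩
  have hfirst : expect (kmeanspp (dataset k m r) k)
      (fun C => if ∃ c ∈ C.getLast?, L ≤ (c.1 : ℕ) then 1 else 0) ≤
        ENNReal.ofReal ((1 / 4) ^ L) := by
    have h := expect_kmeanspp_getLast (dataset k m r) (fun c => L ≤ (c.1 : ℕ)) (k - 1)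
    rw [Nat.sub_add_cancel (by omega)] at h
    exact h.trans_le (expect_uniform_le L)
  have hprog : expect (kmeanspp (dataset k m r) k) (progress L) ≤
      ENNReal.ofReal ((7 / 8) ^ (L + s)) := by
    have h := expect_progress_le (n := n) (by omega) hm hr hdvd L (by omega) (L + s)
    rwa [← hs] at h
  -- Union bound and Markov in one: either the first center is bad, or the rescaled `progress` is at
  -- least `1`.
  refine (toOuterMeasure_le_expect _ _ (f := fun C =>
    (if ∃ c ∈ C.getLast?, L ≤ (c.1 : ℕ) then 1 else 0) +
      ENNReal.ofReal (2 ^ (k / 1000) * (8 / 7) ^ L) * progress L C) ?_).trans ?_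
  · intro C hC hcov
    rw [Set.mem_ofPred_eq, numCovered_eq] at hcov
    have hlen := length_of_mem_support_kmeanspp _ _ C hC
    split_ifs with h
    · exact le_self_add
    · rw [zero_add]
      have hne : C ≠ [] := by rintro rfl; simp at hlen; omega
      have hlast := List.getLast?_eq_some_getLast hne
      refine one_le_mul_progress ⟨⟨_, hlast, ?_⟩, by omega⟩ (by omega)
      exact not_le.1 fun hle => h ⟨_, hlast, hle⟩
  · rw [expect_add, expect_mul_left]
    refine (add_le_add hfirst (mul_le_mul_right hprog _)).trans ?_
    rw [← ENNReal.ofReal_mul (by positivity), ← ENNReal.ofReal_add (by positivity) (by positivity)]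
    refine ENNReal.ofReal_le_ofReal ?_
    have h1 := one_div_four_pow_le (k := k) (L := L) (by omega)
    have h2 := two_pow_mul_seven_div_eight_pow_le (k := k) (a := k / 1000) (s := s) (by omega)
    have h3 : (2 : ℝ) ^ (k / 1000) * (8 / 7) ^ L * (7 / 8) ^ (L + s) =
        2 ^ (k / 1000) * (7 / 8) ^ s := by
      rw [pow_add, mul_assoc, ← mul_assoc ((8 / 7 : ℝ) ^ L), ← mul_pow]
      norm_num
    rw [h3]
    linarith

end KMeansPP

theorem mainTheorem2 (k : ℕ) (hk : 1000 ≤ k) (η : ℝ) (hη : 0.999 ≤ η)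
    (m : ℕ) (hm : 0 < m) (hdvd : 4 ^ (k - 1) ∣ m) (r : ℝ) (hr : 0 < r) :
    haveI : Nonempty (KMeansPP.DataIndex k m) := KMeansPP.dataIndex_nonempty (by omega) hm
    (KMeansPP.kmeanspp (KMeansPP.dataset k m r) k).toOuterMeasure
        {C | η * (k : ℝ) < (KMeansPP.numCovered C : ℝ)} ≤
      ENNReal.ofReal (2 * Real.sqrt (k : ℝ) * (2 : ℝ) ^ (-(k : ℝ) / 300)) := by
  have : Nonempty (KMeansPP.DataIndex k m) := KMeansPP.dataIndex_nonempty (by omega) hm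
  refine (MeasureTheory.OuterMeasure.mono _ fun C hC => ?_).trans
    ((KMeansPP.prob_covered_le hk hm hdvd hr).trans (ENNReal.ofReal_le_ofReal ?_))
  · rw [Set.mem_ofPred_eq] at hC ⊢
    have hk0 : (0 : ℝ) ≤ k := Nat.cast_nonneg k
    have h : (999 : ℝ) * k < 1000 * KMeansPP.numCovered C := by
      norm_num at hη
      nlinarith
    exact_mod_cast h
  · have h1 : 1 ≤ Real.sqrt k := Real.one_le_sqrt.2 (by exact_mod_cast (by omega : 1 ≤ k))
    refine mul_le_mul_of_nonneg_right ?_ (by positivity)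
    linarith
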